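/- Let $p$ be a prime, let $a,m\ge 1$ be integers, and let $GR(p^a,m)$ be the Galois ring of characteristic $p^a$ with $p^{am}$ elements, i.e. $(\mathbb Z/p^a)[y]/\langle h(y)\rangle$ for a monic polynomial $h$ of degree $m$ that is irreducible modulo $p$. Let $f(x)\in GR(p^a,m)[x]$ be regular (that is, not a zero divisor), and let $\mathcal R=GR(p^a,m)[x]/\langle f(x)\rangle$. Then for every nonzero ideal $C$ of $\mathcal R$ there are an integer $r$ with $0\le r\le a-1$, integers $j_0,\dots,j_r$ and polynomials $g_0(x),\dots,g_r(x)\in GR(p^a,m)[x]$ such that $$C=\langle p^{j_0}g_0(x),\dots,p^{j_r}g_r(x)\rangle\quad\text{in }\mathcal R$$ (the generators being read modulo $f(x)$) and 1. $0\le j_0<\dots<j_r\le a-1$; 2. $g_i(x)$ is monic for $i=0,\dots,r$; 3. $\deg f(x)>\deg g_0(x)>\dots>\deg g_r(x)$; 4. $p^{j_{i+1}}g_i(x)\in\langle p^{j_{i+1}}g_{i+1}(x),\dots,p^{j_r}g_r(x)\rangle$ in $GR(p^a,m)[x]$ (hence also in $\mathcal R$) for $0\le i\le r-1$; 5. $p^{j_0}f(x)\in\langle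 p^{j_0}g_0(x),\dots,p^{j_r}g_r(x)\rangle$ in $GR(p^a,m)[x]$. -/

import Mathlib

open Polynomial

/-- `R` is the Galois ring `GR(p^a, m)`: it is isomorphic to `(ℤ/p^a)[X]/(h)` for a monic polynomial
`h` of degree `m` whose reduction modulo `p` is irreducible. (Up to isomorphism the quotient does not
depend on `h`; an integral polynomial is used so as to have both reductions at hand, and every monic
polynomial over `ℤ/p^a` is the reduction of a monic integral one of the same degree.) -/
def IsGaloisRing (p a m : ℕ) (R : Type*) [CommRing R] : Prop :=
  ∃ h : ℤ[X], h.Monic ∧ h.natDegree = m ∧ Irreducible (h.map (Int.castRingHom (ZMod p))) ∧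
    Nonempty (R ≃+* AdjoinRoot (h.map (Int.castRingHom (ZMod (p ^ a)))))

/-! Let `I` be the preimage of `C` in `R[X]`. Every element of `R` is a unit or a multiple of the
nilpotent `p`, so a polynomial not divisible by `p` has a monic multiple of no larger degree
(`exists_mul_monic`). In particular `f` has one, `F`, and it lies in `I`. For each `k` take a monic
`g` of least degree `D k` with `p ^ k * g ∈ I`. Dividing `p ^ k * s ∈ I` by it leaves `p ^ k` times
a remainder which, by minimality, is divisible by `p`; iterating up to `p ^ a = 0` shows that these
elements generate (`mem_of_pow_dvd_of_minimal_monic`). Only the exponents where `D` drops strictly,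
below `deg F`, are needed. Conditions 4 and 5 follow by the same division, started at exponent `j
l`. -/

/-- Multiplication by an element of the base inverts a polynomial with a unit coefficient up to
a multiple of `p`, with a monic result. -/
theorem exists_C_mul_eq_monic_add {R : Type*} [CommRing R] {p : R}
    (hp : ∀ x : R, p ∣ x ∨ IsUnit x) (s : R[X]) (hs : ¬ C p ∣ s) :
    ∃ (c : R) (A B : R[X]), C c * s = A + C p * B ∧ A.Monic ∧ A.natDegree ≤ s.natDegree := by
  induction hn : s.support.card using Nat.strong_induction_on generalizing s with
  | _ n ih =>
    have hs0 : s ≠ 0 := by rintro rfl; exact hs (dvd_zero _)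
    rcases hp s.leadingCoeff with ⟨e, he⟩ | ⟨u, hu⟩
    · have hsplit : s = s.eraseLead + C p * (C e * X ^ s.natDegree) := by
        conv_lhs => rw [← s.eraseLead_add_C_mul_X_pow, he, C_mul, mul_assoc]
      obtain ⟨c, A, B, h, hA, hd⟩ := ih _ (hn ▸ eraseLead_support_card_lt hs0) s.eraseLead
        (fun h => hs (hsplit ▸ dvd_add h (dvd_mul_right _ _))) rfl
      refine ⟨c, A, B + C c * (C e * X ^ s.natDegree), ?_, hA,
        hd.trans (eraseLead_natDegree_le_aux)⟩
      conv_lhs => rw [hsplit]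
      rw [mul_add, h]; ring
    · refine ⟨↑u⁻¹, C (↑u⁻¹ : R) * s, 0, by simp, ?_, natDegree_C_mul_le _ _⟩
      exact monic_C_mul_of_mul_leadingCoeff_eq_one (by rw [← hu]; simp)

/-- Weierstrass division modulo powers of `p`. -/
theorem exists_eq_mul_add_add_pow_mul {R : Type*} [CommRing R] [Nontrivial R] (p : R) {A B : R[X]}
    (hA : A.Monic) (n : ℕ) (t : R[X]) :
    ∃ v r w : R[X], t = v * (A + C p * B) + r + C p ^ n * w ∧ r.degree < A.degree := by
  induction n with
  | zero => exact ⟨0, 0, t, by simp, by simpa [bot_lt_iff_ne_bot] using hA.ne_zero⟩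
  | succ n ih =>
    obtain ⟨v, r, w, h, hr⟩ := ih
    -- Writing `A = (A + p * B) - p * B` in the division of `w` by `A` gives the error one more
    -- factor `p`.
    refine ⟨v + C p ^ n * (w /ₘ A), r + C p ^ n * (w %ₘ A), - ((w /ₘ A) * B), ?_, ?_⟩
    · conv_lhs => rw [h, ← modByMonic_add_div w A]
      ring
    · refine (degree_add_le _ _).trans_lt (max_lt hr ?_)
      rw [← C_pow, ← smul_eq_C_mul]
      exact (degree_smul_le _ _).trans_lt (degree_modByMonic_lt _ hA)

/-- A polynomial with a unit coefficient has a monic multiple of no larger degree. -/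
theorem exists_mul_monic {R : Type*} [CommRing R] {p : R}
    (hp : ∀ x : R, p ∣ x ∨ IsUnit x) (hnil : IsNilpotent p) (s : R[X]) (hs : ¬ C p ∣ s) :
    ∃ v : R[X], (v * s).Monic ∧ (v * s).natDegree ≤ s.natDegree := by
  have : Nontrivial R := by
    by_contra h
    rw [not_nontrivial_iff_subsingleton] at h
    exact hs ⟨0, Subsingleton.elim _ _⟩
  obtain ⟨c, A, B, h, hA, hd⟩ := exists_C_mul_eq_monic_add hp s hs
  obtain ⟨n, hn⟩ := hnil
  obtain ⟨v, r, w, hv, hr⟩ := exists_eq_mul_add_add_pow_mul p (B := B) hA n (X ^ A.natDegree)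
  rw [← C_pow, hn, C_0, zero_mul, add_zero] at hv
  have hr' : (-r).degree < A.natDegree := by
    rwa [degree_neg, ← degree_eq_natDegree hA.ne_zero]
  have key : v * C c * s = X ^ A.natDegree + -r := by rw [hv, mul_assoc, h]; ring
  refine ⟨v * C c, key ▸ monic_X_pow_add hr', ?_⟩
  rw [key, natDegree_add_eq_left_of_degree_lt (by rwa [degree_X_pow]), natDegree_X_pow]
  exact hd

/-- If an ideal `S` contains, for each `k ≥ l`, some `p ^ k * g` with `g` monic of least degree
among those with `p ^ k * g ∈ I`, then `S` contains the multiples of `p ^ l` in `I`. -/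
theorem mem_of_pow_dvd_of_minimal_monic {R : Type*} [CommRing R] {p : R}
    (hp : ∀ x : R, p ∣ x ∨ IsUnit x) {a : ℕ} (hpa : p ^ a = 0) {I S : Ideal R[X]} {l : ℕ}
    (hS : ∀ k, l ≤ k → k < a → ∃ g : R[X], g.Monic ∧ C p ^ k * g ∈ S ∧ C p ^ k * g ∈ I ∧
      ∀ g' : R[X], g'.Monic → C p ^ k * g' ∈ I → g.natDegree ≤ g'.natDegree)
    {q : R[X]} (hq : q ∈ I) (hdvd : C p ^ l ∣ q) : q ∈ S := by
  suffices H : ∀ n k, l ≤ k → a ≤ k + n → ∀ q ∈ I, C p ^ k ∣ q → q ∈ S from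
    H a l le_rfl (by omega) q hq hdvd
  intro n
  induction n with
  | zero =>
    rintro k - hk q - ⟨s, rfl⟩
    rw [← C_pow, pow_eq_zero_of_le (by simpa using hk) hpa]
    simp
  | succ n ih =>
    rintro k hlk hk q hq ⟨s, rfl⟩
    by_cases hka : k < a
    · obtain ⟨g, hg, hgS, hgI, hmin⟩ := hS k hlk hka
      have hsplit : C p ^ k * s = C p ^ k * (s %ₘ g) + (s /ₘ g) * (C p ^ k * g) := by
        conv_lhs => rw [← modByMonic_add_div s g]
        ring
      have hrI : C p ^ k * (s %ₘ g) ∈ I := by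
        rw [← sub_eq_iff_eq_add] at hsplit
        exact hsplit ▸ I.sub_mem hq (I.mul_mem_left _ hgI)
      have hpr : C p ∣ s %ₘ g := by
        by_contra hnot
        obtain ⟨v, hv, hvd⟩ := exists_mul_monic hp ⟨a, hpa⟩ _ hnot
        have h1 := hmin _ hv (by rw [mul_left_comm]; exact I.mul_mem_left _ hrI)
        -- The strict bound on `natDegree` fails for `g = 1`, where the remainder is zero.
        have hg1 : g ≠ 1 := by
          rintro rfl
          exact hnot (by simp)
        exact absurd (natDegree_modByMonic_lt s hg hg1) (by omega)
      rw [hsplit]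
      refine S.add_mem (ih (k + 1) (by omega) (by omega) _ hrI ?_) (S.mul_mem_left _ hgS)
      rw [pow_succ]
      exact mul_dvd_mul_left _ hpr
    · rw [← C_pow, pow_eq_zero_of_le (not_lt.mp hka) hpa]
      simp

/-- An antitone sequence attains, at an index that is a strict record, each of its values. -/
theorem exists_record_eq {D : ℕ → ℕ} (hD : Antitone D) {l k : ℕ} (hlk : l ≤ k)
    (hl : ∀ i < l, D l < D i) :
    ∃ j, l ≤ j ∧ j ≤ k ∧ D j = D k ∧ ∀ i < j, D j < D i := by
  induction k, hlk using Nat.le_induction with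
  | base => exact ⟨l, le_rfl, le_rfl, rfl, hl⟩
  | succ k hk ih =>
    by_cases h : D (k + 1) < D k
    · exact ⟨k + 1, by omega, le_rfl, rfl, fun i hi => h.trans_le (hD (by omega))⟩
    · obtain ⟨j, h1, h2, h3, h4⟩ := ih
      exact ⟨j, h1, by omega, h3.trans (le_antisymm (not_lt.mp h) (hD (by omega))), h4⟩

/-- Standard generators of an ideal of `R[X]` that contains a monic polynomial, for a local ring
`R` whose maximal ideal is generated by a nilpotent element. -/
theorem exists_monic_generators {R : Type*} [CommRing R] [Nontrivial R] {p : R}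
    (hp : ∀ x : R, p ∣ x ∨ IsUnit x) {a : ℕ} (hpa : p ^ a = 0) (I : Ideal R[X]) {F : R[X]}
    (hF : F.Monic) (hFI : F ∈ I) (hI : ¬ I ≤ Ideal.span {F}) :
    ∃ (r : ℕ) (j : Fin (r + 1) → ℕ) (g : Fin (r + 1) → R[X]),
      r < a ∧ I = Ideal.span (Set.range fun i => C p ^ j i * g i) ⊔ Ideal.span {F} ∧
      StrictMono j ∧ (∀ i, j i < a) ∧ (∀ i, (g i).Monic) ∧
      (g 0).degree < F.degree ∧ StrictAnti (fun i => (g i).degree) ∧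
      ∀ l, ∀ q ∈ I, C p ^ j l ∣ q →
        q ∈ Ideal.span {q | ∃ k, l ≤ k ∧ q = C p ^ j k * g k} := by
  classical
  have hex : ∀ k, ∃ d, ∃ g : R[X], g.Monic ∧ C p ^ k * g ∈ I ∧ g.natDegree = d := fun k =>
    ⟨_, F, hF, I.mul_mem_left _ hFI, rfl⟩
  let D : ℕ → ℕ := fun k => Nat.find (hex k)
  have hDle : ∀ k (g : R[X]), g.Monic → C p ^ k * g ∈ I → D k ≤ g.natDegree :=
    fun k g h1 h2 => Nat.find_min' (hex k) ⟨g, h1, h2, rfl⟩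
  choose G hGm hGI hGd using fun k => Nat.find_spec (hex k)
  change ∀ k, (G k).natDegree = D k at hGd
  have hDanti : Antitone D := antitone_nat_of_succ_le fun k => by
    rw [← hGd k]
    refine hDle _ _ (hGm k) ?_
    rw [pow_succ', mul_assoc]
    exact I.mul_mem_left _ (hGI k)
  have hmin : ∀ k (g' : R[X]), g'.Monic → C p ^ k * g' ∈ I → (G k).natDegree ≤ g'.natDegree :=
    fun k g' h1 h2 => (hGd k).trans_le (hDle k g' h1 h2)
  have hFmin : ∀ k, D k = F.natDegree →
      ∃ g : R[X], g.Monic ∧ C p ^ k * g ∈ Ideal.span {F} ∧ C p ^ k * g ∈ I ∧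
        ∀ g' : R[X], g'.Monic → C p ^ k * g' ∈ I → g.natDegree ≤ g'.natDegree :=
    fun k hk => ⟨F, hF, Ideal.mul_mem_left _ _ (Ideal.mem_span_singleton_self F),
      I.mul_mem_left _ hFI, fun g' h1 h2 => hk ▸ hDle k g' h1 h2⟩
  have hDF : ∀ k, D k ≤ F.natDegree := fun k => hDle k F hF (I.mul_mem_left _ hFI)
  let J : Finset ℕ := (Finset.range a).filter fun k => D k < F.natDegree ∧ ∀ i < k, D k < D i
  have hJ : ∀ k, k ∈ J ↔ k < a ∧ D k < F.natDegree ∧ ∀ i < k, D k < D i := fun k => by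
    simp [J]
  have hdeg : ∀ {g g' : R[X]}, g.Monic → g'.Monic → g.natDegree < g'.natDegree →
      g.degree < g'.degree := fun h h' hlt => by
    rw [degree_eq_natDegree h.ne_zero, degree_eq_natDegree h'.ne_zero]
    exact_mod_cast hlt
  -- before the first index with `D k < F.natDegree`, `F` itself is minimal
  have hfirst : ∀ k, k < a → D k ≠ F.natDegree → ∃ j ∈ J, j ≤ k ∧ D j = D k := by
    intro k hk hne
    obtain ⟨j, -, h2, h3, h4⟩ := exists_record_eq hDanti (Nat.zero_le k) (by simp)
    exact ⟨j, (hJ j).2 ⟨by omega, by have := hDF k; omega, h4⟩, h2, h3⟩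
  have hJne : J.card ≠ 0 := by
    intro h0
    rw [Finset.card_eq_zero] at h0
    refine hI fun q hq => mem_of_pow_dvd_of_minimal_monic hp hpa (l := 0) (fun k _ hk => ?_) hq
      (by simp)
    refine hFmin k ?_
    by_contra hne
    obtain ⟨j, hj, -⟩ := hfirst k hk hne
    simp [h0] at hj
  obtain ⟨r, hr⟩ := Nat.exists_eq_succ_of_ne_zero hJne
  let e := J.orderIsoOfFin hr
  have heJ : ∀ i, (e i : ℕ) < a ∧ D (e i) < F.natDegree ∧ ∀ i' < (e i : ℕ), D (e i) < D i' :=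
    fun i => (hJ _).1 (e i).2
  have hsurj : ∀ k ∈ J, ∃ i, (e i : ℕ) = k := fun k hk => ⟨e.symm ⟨k, hk⟩, by simp⟩
  have hemono : StrictMono fun i => (e i : ℕ) := fun i i' h => e.strictMono h
  refine ⟨r, fun i => e i, fun i => G (e i), ?_, ?_, hemono, fun i => (heJ i).1,
    fun i => hGm _, hdeg (hGm _) hF (by rw [hGd]; exact (heJ 0).2.1), ?_, ?_⟩
  · have : J.card ≤ a := (Finset.card_filter_le _ _).trans (by simp)
    omega
  · refine le_antisymm (fun q hq => ?_) ?_
    · refine mem_of_pow_dvd_of_minimal_monic hp hpa (l := 0) (fun k _ hk => ?_) hq (by simp)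
      by_cases hne : D k = F.natDegree
      · obtain ⟨g, h1, h2, h3⟩ := hFmin k hne
        exact ⟨g, h1, Ideal.mem_sup_right h2, h3⟩
      · obtain ⟨j, hj, hjk, hDj⟩ := hfirst k hk hne
        obtain ⟨i, rfl⟩ := hsurj j hj
        have hsplit : C p ^ k * G (e i) = C p ^ (k - e i) * (C p ^ (e i : ℕ) * G (e i)) := by
          rw [← mul_assoc, ← pow_add, Nat.sub_add_cancel hjk]
        refine ⟨G (e i), hGm _, Ideal.mem_sup_left ?_, ?_, fun g' h1 h2 => ?_⟩
        · rw [hsplit]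
          exact Ideal.mul_mem_left _ _ (Ideal.subset_span ⟨i, rfl⟩)
        · exact hsplit ▸ I.mul_mem_left _ (hGI _)
        · rw [hGd, hDj]
          exact hDle k g' h1 h2
    · refine sup_le (Ideal.span_le.2 ?_) (Ideal.span_le.2 (by simpa using hFI))
      rintro _ ⟨i, rfl⟩
      exact hGI _
  · intro i i' h
    refine hdeg (hGm _) (hGm _) ?_
    rw [hGd, hGd]
    exact (heJ i').2.2 _ (hemono h)
  · intro l q hq hdvd
    refine mem_of_pow_dvd_of_minimal_monic hp hpa (fun k hlk hk => ?_) hq hdvd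
    -- Since `l` indexes a record, the record with value `D k` can be taken at or after it, so only
    -- later generators are used.
    obtain ⟨j, h1, h2, h3, h4⟩ := exists_record_eq hDanti hlk (heJ l).2.2
    have hjJ : j ∈ J := (hJ j).2 ⟨by omega, (hDanti h1).trans_lt (heJ l).2.1, h4⟩
    obtain ⟨i, rfl⟩ := hsurj j hjJ
    have hsplit : C p ^ k * G (e i) = C p ^ (k - e i) * (C p ^ (e i : ℕ) * G (e i)) := by
      rw [← mul_assoc, ← pow_add, Nat.sub_add_cancel h2]
    refine ⟨G (e i), hGm _, ?_, ?_, fun g' h1 h2 => ?_⟩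
    · rw [hsplit]
      exact Ideal.mul_mem_left _ _ (Ideal.subset_span ⟨i, hemono.le_iff_le.1 h1, rfl⟩)
    · exact hsplit ▸ I.mul_mem_left _ (hGI _)
    · rw [hGd, h3]
      exact hDle k g' h1 h2

namespace IsGaloisRing

variable {p a m : ℕ} {R : Type*} [CommRing R]

theorem natCast_pow_eq_zero (hR : IsGaloisRing p a m R) : (p : R) ^ a = 0 := by
  obtain ⟨h, -, -, -, ⟨e⟩⟩ := hR
  apply e.injective
  rw [map_pow, map_natCast, map_zero, ← Nat.cast_pow,
    ← map_natCast (AdjoinRoot.of (h.map (Int.castRingHom (ZMod (p ^ a))))), ZMod.natCast_self,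
    map_zero]

theorem natCast_pow_ne_zero [Fact p.Prime] (hR : IsGaloisRing p a m R) {k : ℕ} (hk : k < a) :
    (p : R) ^ k ≠ 0 := by
  have hp : p.Prime := Fact.out
  obtain ⟨h, hm, -, hirr, ⟨e⟩⟩ := hR
  have : Fact (1 < p ^ a) := ⟨Nat.one_lt_pow (by omega) hp.one_lt⟩
  intro h0
  replace h0 := congrArg e h0
  rw [map_pow, map_natCast, map_zero, ← Nat.cast_pow,
    ← map_natCast (AdjoinRoot.mk (h.map (Int.castRingHom (ZMod (p ^ a))))),
    AdjoinRoot.mk_eq_zero] at h0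
  have hdeg : 0 < (h.map (Int.castRingHom (ZMod (p ^ a)))).degree := by
    have := hirr.degree_pos
    rwa [hm.degree_map] at this ⊢
  have hz : ((p ^ k : ℕ) : (ZMod (p ^ a))[X]) = 0 := by
    by_contra hne
    refine (hm.map _).not_dvd_of_degree_lt hne ?_ h0
    rw [← C_eq_natCast]
    exact degree_C_le.trans_lt hdeg
  rw [← C_eq_natCast, C_eq_zero, ZMod.natCast_eq_zero_iff, Nat.pow_dvd_pow_iff_le_right hp.one_lt]
    at hz
  omega

/-- Lift `x` to `q` in `ℤ[X]`. Modulo `p`, either `h` divides `q`, or Bézout gives `v * q ≡ 1`; then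
`x` divides `1 + p * w`, a unit because `p` is nilpotent. -/
theorem dvd_or_isUnit [Fact p.Prime] (hR : IsGaloisRing p a m R) (x : R) :
    (p : R) ∣ x ∨ IsUnit x := by
  have hnil : IsNilpotent (p : R) := ⟨a, hR.natCast_pow_eq_zero⟩
  obtain ⟨h, -, -, hirr, ⟨e⟩⟩ := hR
  let φ : ℤ[X] →+* R := (e.symm : _ →+* R).comp
    ((AdjoinRoot.mk (h.map (Int.castRingHom (ZMod (p ^ a))))).comp
      (mapRingHom (Int.castRingHom (ZMod (p ^ a)))))
  have hφ : Function.Surjective φ := e.symm.surjective.comp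
    (AdjoinRoot.mk_surjective.comp (map_surjective _ ZMod.intCast_surjective))
  have hφh : φ h = 0 := by simp [φ]
  have hred : Function.Surjective (Polynomial.map (Int.castRingHom (ZMod p))) :=
    map_surjective _ ZMod.intCast_surjective
  have hker : ∀ q q' : ℤ[X],
      q.map (Int.castRingHom (ZMod p)) = q'.map (Int.castRingHom (ZMod p)) →
        ∃ w, q = q' + (p : ℤ[X]) * w := by
    intro q q' hqq
    have hdvd : C (p : ℤ) ∣ q - q' := by
      rw [C_dvd_iff_dvd_coeff]
      intro i
      have := congrArg (fun t => coeff t i) hqq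
      rw [← ZMod.intCast_zmod_eq_zero_iff_dvd]
      simpa [sub_eq_zero] using this
    obtain ⟨w, hw⟩ := hdvd
    exact ⟨w, by rw [← sub_eq_iff_eq_add', hw]; simp⟩
  obtain ⟨q, rfl⟩ := hφ x
  rcases (EuclideanDomain.dvd_or_coprime _ (q.map (Int.castRingHom (ZMod p))) hirr) with
    ⟨t, ht⟩ | ⟨u, v, huv⟩
  · obtain ⟨t, rfl⟩ := hred t
    obtain ⟨w, hw⟩ := hker q (h * t) (by simpa using ht)
    exact Or.inl ⟨φ w, by rw [hw]; simp [hφh]⟩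
  · obtain ⟨u, rfl⟩ := hred u
    obtain ⟨v, rfl⟩ := hred v
    obtain ⟨w, hw⟩ := hker (u * h + v * q) 1 (by simpa using huv)
    have hφw := congrArg φ hw
    simp only [map_add, map_mul, hφh, mul_zero, zero_add, map_one, map_natCast] at hφw
    right
    refine isUnit_of_mul_isUnit_right (x := φ v) ?_
    rw [hφw]
    exact ((Commute.all _ _).isNilpotent_mul_right hnil).isUnit_one_add

end IsGaloisRing

theorem theorem5p5 (p a m : ℕ) [Fact p.Prime] (ha : 1 ≤ a) (hm : 1 ≤ m)
    {R : Type*} [CommRing R] (hR : IsGaloisRing p a m R)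
    (f : R[X]) (hf : f ∈ nonZeroDivisors R[X])
    (C : Ideal (R[X] ⧸ Ideal.span {f})) (hC : C ≠ ⊥) :
    ∃ (r : ℕ) (j : Fin (r + 1) → ℕ) (g : Fin (r + 1) → R[X]),
      r < a ∧
      C = Ideal.span (Set.range fun i =>
        Ideal.Quotient.mk (Ideal.span {f}) ((p : R[X]) ^ j i * g i)) ∧
      StrictMono j ∧ (∀ i, j i < a) ∧
      (∀ i, (g i).Monic) ∧
      (g 0).degree < f.degree ∧ StrictAnti (fun i => (g i).degree) ∧
      (∀ i : Fin r, (p : R[X]) ^ j i.succ * g i.castSucc ∈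
        Ideal.span {q | ∃ k, i.succ ≤ k ∧ q = (p : R[X]) ^ j k * g k}) ∧
      (p : R[X]) ^ j 0 * f ∈ Ideal.span (Set.range fun i => (p : R[X]) ^ j i * g i) := by
  have hpa := hR.natCast_pow_eq_zero
  have hp := hR.dvd_or_isUnit
  have hp0 : (p : R) ^ (a - 1) ≠ 0 := hR.natCast_pow_ne_zero (by omega)
  have : Nontrivial R := nontrivial_of_ne _ _ hp0
  have hCp : (p : R[X]) = Polynomial.C (p : R) := (C_eq_natCast p).symm
  -- A multiple of `p` is killed by `p ^ (a - 1) ≠ 0`, so it is not regular.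
  have hfp : ¬ Polynomial.C (p : R) ∣ f := by
    rintro ⟨t, rfl⟩
    have := (mem_nonZeroDivisors_iff.1 hf).1 (Polynomial.C ((p : R) ^ (a - 1)))
      (by rw [mul_right_comm, ← C_mul, ← pow_succ', Nat.sub_add_cancel ha, hpa]; simp)
    exact hp0 (C_eq_zero.1 this)
  obtain ⟨v, hv, hvd⟩ := exists_mul_monic hp ⟨a, hpa⟩ f hfp
  have hf0 : f ≠ 0 := by rintro rfl; simp at hfp
  have hFle : (v * f).degree ≤ f.degree := by
    rw [degree_eq_natDegree hv.ne_zero, degree_eq_natDegree hf0]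
    exact_mod_cast hvd
  set π := Ideal.Quotient.mk (Ideal.span {f})
  have hπ : Function.Surjective π := Ideal.Quotient.mk_surjective
  have hπf : π f = 0 := Ideal.Quotient.eq_zero_iff_mem.2 (Ideal.mem_span_singleton_self f)
  have hfI : f ∈ C.comap π := by simp [Ideal.mem_comap, hπf]
  have hmap : (C.comap π).map π = C := Ideal.map_comap_of_surjective π hπ C
  -- Hence the extra generator `F = v * f` vanishes in the quotient, and `C ≠ ⊥` keeps `I` from
  -- lying in `⟨F⟩`.
  have hmapF : (Ideal.span {v * f}).map π = ⊥ := by simp [Ideal.map_span, hπf]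
  obtain ⟨r, j, g, h1, h2, h3, h4, h5, h6, h7, h8⟩ :=
    exists_monic_generators hp hpa (C.comap π) hv (Ideal.mul_mem_left _ _ hfI) fun hle =>
      hC (le_bot_iff.1 (hmap ▸ hmapF ▸ Ideal.map_mono hle))
  have hgen : ∀ i, Polynomial.C (p : R) ^ j i * g i ∈ C.comap π := fun i => by
    rw [h2]
    exact Ideal.mem_sup_left (Ideal.subset_span ⟨i, rfl⟩)
  rw [hCp]
  refine ⟨r, j, g, h1, ?_, h3, h4, h5, h6.trans_le hFle, h7, fun i => ?_, ?_⟩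
  · rw [← hmap, h2, Ideal.map_sup, hmapF, sup_bot_eq, Ideal.map_span, ← Set.range_comp]
    rfl
  · refine h8 _ _ ?_ (dvd_mul_right _ _)
    have hlt : j i.castSucc ≤ j i.succ := h3.monotone i.castSucc_lt_succ.le
    rw [← Nat.sub_add_cancel hlt, pow_add, mul_assoc]
    exact Ideal.mul_mem_left _ _ (hgen _)
  · refine Ideal.span_mono ?_ (h8 0 _ (Ideal.mul_mem_left _ _ hfI) (dvd_mul_right _ _))
    rintro _ ⟨k, -, rfl⟩
    exact ⟨k, rfl⟩
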